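/- **Theorem ($\epsilon$-dependent lower bound for continuous-query simulation).** For $x\in\{0,1\}^N$ let $H_x$ and $Q_x$ act on $\mathbb{C}^N\otimes\mathbb{C}^2$ by $H_x|j\rangle|b\rangle=\pi b x_j|j\rangle|b\rangle$ and $Q_x|j\rangle|b\rangle=(-1)^{b x_j}|j\rangle|b\rangle$ ($j\in[N]$, $b\in\{0,1\}$); on a larger space they act as the identity on the remaining registers. Given an $x$-independent driving Hamiltonian $H_D(t)$, $t\in[0,T]$ (Hermitian, integrable in $t$, acting on $\mathbb{C}^N\otimes\mathbb{C}^2\otimes\mathbb{C}^W$ for a finite workspace $W$), let $U_x(T)$ be the unitary obtained by solving $i\,\frac{\mathrm d}{\mathrm dt}U_x(t)=(H_x+H_D(t))\,U_x(t)$, $U_x(0)=I$ (in integrated form). A discrete-query circuit with $q$ queries is a product $C_x=G_qQ_xG_{q-1}\cdots G_1Q_xG_0$ of $x$-independent unitaries $G_i$ and $q$ query gates on $\mathbb{C}^N\otimes\mathbb{C}^2\otimes\mathbb{C}^W\otimes\mathbb{C}^A$, with any finite ancilla register $A$ initialized to an $x$-independent unit vector $|\chi\rangle$. It simulates $H_x+H_D(t)$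 for time $T$ with precision $\epsilon$ if for every $x$ there is a unit vector $|\varphi_x\rangle\in\mathbb{C}^A$ such that $\bigl\|C_x(|\psi\rangle|\chi\rangle)-(U_x(T)|\psi\rangle)|\varphi_x\rangle\bigr\|\le\epsilon\,\||\psi\rangle\|$ for all $|\psi\rangle$. Let $T>0$ and $0<c_1\le c_2$ be constants. There are $\kappa>0$ and $\epsilon_0>0$, depending only on $T,c_1,c_2$, such that for every $0<\epsilon<\epsilon_0$ and every $N\in\mathbb{N}$ with $$c_1\,\frac{\log(1/\epsilon)}{\log\log(1/\epsilon)}\;\le\;N\;\le\;c_2\,\frac{\log(1/\epsilon)}{\log\log(1/\epsilon)}$$ there exist a finite workspace and a driving Hamiltonian $H_D(t)$, $t\in[0,T]$, independent of $x\in\{0,1\}^N$, such that every discrete-query circuit that simulates $H_x+H_D(t)$ for time $T$ with precision $\epsilon$ makes at least $\kappa N$ queries. That is, for $N=\Theta\bigl(\frac{\log(1/\epsilon)}{\log\log(1/\epsilon)}\bigr)$, simulating $H_x+H_D(t)$ for constant time with precision $\epsilon$ requires $\Omega(N)$ discrete queries. -/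

import Mathlib

open MeasureTheory

noncomputable section

namespace ContinuousQuery

/-- Computational basis of the query register `|j⟩|b⟩`, `j ∈ [N]`, `b ∈ {0,1}`, together with a
workspace register with basis `E`. -/
abbrev Basis (N : ℕ) (E : Type) : Type := (Fin N × Bool) × E

/-- The query Hamiltonian `H_x |j⟩|b⟩ = π b x_j |j⟩|b⟩`, tensored with the identity on the
workspace. -/
def queryHamiltonian {N : ℕ} (E : Type) [DecidableEq E] (x : Fin N → Bool) :
    Matrix (Basis N E) (Basis N E) ℂ :=
  Matrix.diagonal fun s => if s.1.2 && x s.1.1 then (Real.pi : ℂ) else 0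

/-- The discrete query gate `Q_x |j⟩|b⟩ = (-1)^(b x_j) |j⟩|b⟩`, tensored with the identity on the
workspace. -/
def queryGate {N : ℕ} (E : Type) [DecidableEq E] (x : Fin N → Bool) :
    Matrix (Basis N E) (Basis N E) ℂ :=
  Matrix.diagonal fun s => if s.1.2 && x s.1.1 then (-1 : ℂ) else 1

/-- An (input-independent) driving Hamiltonian on the time interval `[0, T]`: a family of Hermitian
matrices with integrable entries. -/
structure DrivingHamiltonian (N : ℕ) (W : Type) (T : ℝ) where
  H : ℝ → Matrix (Basis N W) (Basis N W) ℂ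
  hermitian : ∀ t ∈ Set.Icc 0 T, (H t).IsHermitian
  integrable : ∀ r s, IntervalIntegrable (fun t => H t r s) volume 0 T

/-- `U` solves the Schrödinger equation `i U'(t) = (H_x + H_D(t)) U(t)`, `U(0) = 1`, on `[0, T]`.
Since `H_D` need only be integrable in time (for instance piecewise constant), the equation is
stated in its integrated form
`U(t) = 1 - i ∫₀ᵗ (H_x + H_D(s)) U(s) ds` (entrywise), with `U` continuous. -/
structure IsPropagator {N : ℕ} {W : Type} [Fintype W] [DecidableEq W] {T : ℝ}
    (D : DrivingHamiltonian N W T) (x : Fin N → Bool)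
    (U : ℝ → Matrix (Basis N W) (Basis N W) ℂ) : Prop where
  continuousOn : ContinuousOn U (Set.Icc 0 T)
  schrodinger : ∀ t ∈ Set.Icc 0 T, ∀ r s,
    U t r s = (1 : Matrix (Basis N W) (Basis N W) ℂ) r s
      - Complex.I * ∫ τ in (0 : ℝ)..t, ((queryHamiltonian W x + D.H τ) * U τ) r s

/-- The unitary `G_q Q_x G_{q-1} ⋯ G_1 Q_x G_0` performed on input `x` by the discrete-query circuit
with `q` queries and input-independent gates `G_0, …, G_q`. -/
def circuit {N : ℕ} {E : Type} [Fintype E] [DecidableEq E]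
    (G : ℕ → Matrix.unitaryGroup (Basis N E) ℂ) (x : Fin N → Bool) :
    ℕ → Matrix (Basis N E) (Basis N E) ℂ
  | 0 => (G 0 : Matrix (Basis N E) (Basis N E) ℂ)
  | q + 1 => (G (q + 1) : Matrix (Basis N E) (Basis N E) ℂ) * queryGate E x * circuit G x q

/-- The product state `|ψ⟩|χ⟩` of a state of the system and a state of an ancilla register. -/
def withAncilla {N : ℕ} {W A : Type} (ψ : EuclideanSpace ℂ (Basis N W))
    (χ : EuclideanSpace ℂ A) : EuclideanSpace ℂ (Basis N (W × A)) :=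
  WithLp.toLp 2 fun s => ψ (s.1, s.2.1) * χ s.2.2

/-- The `q`-query discrete circuit with gates `G`, run with its ancilla register initialized to the
state `χ`, implements the unitary `V x` with error at most `ε` for every input `x`. The ancilla may
end in any state `φ` (possibly depending on `x`); the requirement that it be returned to `χ` is the
special case `φ = χ`. -/
def Simulates {N : ℕ} {W A : Type} [Fintype W] [DecidableEq W] [Fintype A] [DecidableEq A]
    (q : ℕ) (G : ℕ → Matrix.unitaryGroup (Basis N (W × A)) ℂ) (χ : EuclideanSpace ℂ A)
    (V : (Fin N → Bool) → Matrix (Basis N W) (Basis N W) ℂ) (ε : ℝ) : Prop :=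
  ∀ x, ∃ φ : EuclideanSpace ℂ A, ‖φ‖ = 1 ∧ ∀ ψ : EuclideanSpace ℂ (Basis N W),
    ‖Matrix.toEuclideanLin (circuit G x q) (withAncilla ψ χ)
      - withAncilla (Matrix.toEuclideanLin (V x) ψ) φ‖ ≤ ε * ‖ψ‖

/-- The rate `log(1/ε) / log log(1/ε)`. -/
def rate (ε : ℝ) : ℝ := Real.log (1 / ε) / Real.log (Real.log (1 / ε))

end ContinuousQuery

end

/-! The amplitudes of a `q`-query circuit are polynomials of degree at most `q` in the bits of `x`,
so their alternating sum over a subcube of dimension `m > q` vanishes. The continuous model can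
produce an amplitude of full degree. Split `[0, T]` into `m` slots of length `δ = T / m`; in slot
`j` apply a resonant pulse from a fixed state `h` with `b = 0` to `|j⟩|1⟩`. If `x_j = 0` the pulse
empties `h`; if `x_j = 1` the query Hamiltonian detunes it by `π`, and a survival amplitude of
modulus at least `1 / (1 + m / T)` remains. Slots multiply (`exists_propagator_prod`), so the final
amplitude at `h` is a small constant times the AND of `m` bits.

The alternating sum of the circuit's amplitudes has `2 ^ m` terms, each with error at most `ε`, and
only the all-ones term has a nonzero target (`Simulates.norm_le_two_pow_mul`). Hence `q < m` forces
`1 ≤ (2 * (1 + m / T)) ^ m * ε`, which fails when `m` is a small multiple of `log(1/ε) / log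
log(1/ε)`. -/

noncomputable section

namespace ContinuousQuery

/-! ### The polynomial method on subcubes -/

/-- The input `x ∈ {0,1}^N` with support `s`. -/
def inputOfSupport {N : ℕ} (s : Finset (Fin N)) : Fin N → Bool := fun j => decide (j ∈ s)

/-- Functions of the support of `x ∈ {0,1}^N` given by polynomials in `x` of degree at most `d`. -/
def degreeLE (N d : ℕ) : Submodule ℂ (Finset (Fin N) → ℂ) :=
  Submodule.span ℂ {f | ∃ t : Finset (Fin N), t.card ≤ d ∧ f = fun s => if t ⊆ s then 1 else 0}

theorem degreeLE_mono {N d e : ℕ} (h : d ≤ e) : degreeLE N d ≤ degreeLE N e :=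
  Submodule.span_mono fun _ ⟨t, ht, hf⟩ => ⟨t, ht.trans h, hf⟩

theorem const_mem_degreeLE (N d : ℕ) (c : ℂ) : (fun _ => c) ∈ degreeLE N d := by
  have h : (fun s : Finset (Fin N) => if (∅ : Finset (Fin N)) ⊆ s then (1 : ℂ) else 0)
      ∈ degreeLE N d := Submodule.subset_span ⟨∅, by simp, rfl⟩
  convert (degreeLE N d).smul_mem c h using 1
  ext s
  simp

/-- Since `x_j ^ 2 = x_j`, multiplying the monomial of `t` by `x_j` gives the monomial of `insert j
t`. -/
theorem ite_mem_mul_mem_degreeLE {N d : ℕ} (j : Fin N) {f : Finset (Fin N) → ℂ}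
    (hf : f ∈ degreeLE N d) : (fun s => if j ∈ s then f s else 0) ∈ degreeLE N (d + 1) := by
  induction hf using Submodule.span_induction with
  | mem f hf =>
    obtain ⟨t, ht, rfl⟩ := hf
    refine Submodule.subset_span ⟨insert j t, (Finset.card_insert_le _ _).trans (by omega), ?_⟩
    ext s
    by_cases hj : j ∈ s <;> simp [Finset.insert_subset_iff, hj]
  | zero => simp only [Pi.zero_apply, ite_self]; exact const_mem_degreeLE N _ 0
  | add f g _ _ hf hg =>
    convert Submodule.add_mem _ hf hg using 1
    ext s
    by_cases hj : j ∈ s <;> simp [hj]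
  | smul c f _ hf =>
    convert Submodule.smul_mem _ c hf using 1
    ext s
    by_cases hj : j ∈ s <;> simp [hj]

/-- The top alternating sum over a subcube of dimension greater than the degree vanishes. -/
theorem sum_powerset_neg_one_pow_mul_eq_zero {N d : ℕ} {J : Finset (Fin N)} (hJ : d < J.card)
    {f : Finset (Fin N) → ℂ} (hf : f ∈ degreeLE N d) :
    ∑ s ∈ J.powerset, (-1 : ℂ) ^ s.card * f s = 0 := by
  induction hf using Submodule.span_induction with
  | mem f hf =>
    obtain ⟨t, ht, rfl⟩ := hf
    -- Toggling a `j ∈ J` outside `t` fixes the monomial and flips the sign, so the terms cancel in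
    -- pairs.
    obtain ⟨j, hjJ, hjt⟩ : ∃ j ∈ J, j ∉ t := by
      by_contra! h
      exact absurd (Finset.card_le_card (show J ⊆ t from h)) (by omega)
    have hsub : ∀ s : Finset (Fin N), (t ⊆ insert j s ↔ t ⊆ s) := fun s => by
      rw [Finset.subset_insert_iff_of_notMem hjt]
    obtain ⟨J', hj', rfl⟩ : ∃ J', j ∉ J' ∧ insert j J' = J :=
      ⟨J.erase j, Finset.notMem_erase _ _, Finset.insert_erase hjJ⟩
    rw [Finset.sum_powerset_insert hj', ← Finset.sum_add_distrib]
    refine Finset.sum_eq_zero fun s hs => ?_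
    have : j ∉ s := fun h => hj' (Finset.mem_powerset.1 hs h)
    rw [Finset.card_insert_of_notMem this]
    simp only [hsub]
    ring
  | zero => simp
  | add f g _ _ hf hg => simp only [Pi.add_apply, mul_add, Finset.sum_add_distrib, hf, hg, add_zero]
  | smul c f _ hf =>
    simp only [Pi.smul_apply, smul_eq_mul, mul_left_comm _ c, ← Finset.mul_sum, hf, mul_zero]

theorem sum_const_mul_mem_degreeLE {N d : ℕ} {ι : Type*} [Fintype ι] (c : ι → ℂ)
    {f : ι → Finset (Fin N) → ℂ} (hf : ∀ i, f i ∈ degreeLE N d) :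
    (fun s => ∑ i, c i * f i s) ∈ degreeLE N d := by
  convert Submodule.sum_mem (degreeLE N d) (t := Finset.univ)
    fun i _ => Submodule.smul_mem _ (c i) (hf i) using 1
  ext s
  simp

/-- The entries of a circuit with `q` queries are polynomials of degree at most `q`. -/
theorem circuit_mem_degreeLE {N : ℕ} {E : Type} [Fintype E] [DecidableEq E]
    (G : ℕ → Matrix.unitaryGroup (Basis N E) ℂ) (q : ℕ) (r c : Basis N E) :
    (fun s => circuit G (inputOfSupport s) q r c) ∈ degreeLE N q := by
  induction q generalizing r with
  | zero => exact const_mem_degreeLE N 0 _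
  | succ q ih =>
    have h : ∀ i : Basis N E, (fun s : Finset (Fin N) =>
        (if i.1.2 && inputOfSupport s i.1.1 then (-1 : ℂ) else 1)
          * circuit G (inputOfSupport s) q i c) ∈ degreeLE N (q + 1) := fun i => by
      rcases hb : i.1.2 with _ | _
      · simpa using degreeLE_mono (Nat.le_succ q) (ih i)
      -- `(-1) ^ x_j = 1 - 2 * x_j`: each query raises the degree by at most one.
      · convert Submodule.add_mem _ (degreeLE_mono (Nat.le_succ q) (ih i))
          (Submodule.smul_mem _ (-2 : ℂ) (ite_mem_mul_mem_degreeLE i.1.1 (ih i))) using 1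
        ext s
        by_cases hj : i.1.1 ∈ s <;> simp [inputOfSupport, hj]
        ring
    convert sum_const_mul_mem_degreeLE (fun i => (G (q + 1) : Matrix _ _ ℂ) r i) h using 1
    ext s
    simp only [circuit, queryGate, Matrix.mul_assoc, Matrix.mul_apply (M := (G (q + 1)).1),
      Matrix.diagonal_mul]

/-! ### Concatenation of time evolutions -/

/-- The driving Hamiltonian that follows `D` up to time `T` and is constantly `K` afterwards. -/
def DrivingHamiltonian.append {N : ℕ} {W : Type} {T : ℝ} (D : DrivingHamiltonian N W T)
    (hT : 0 ≤ T) {δ : ℝ} (hδ : 0 ≤ δ) (K : Matrix (Basis N W) (Basis N W) ℂ)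
    (hK : K.IsHermitian) : DrivingHamiltonian N W (T + δ) where
  H t := if t ≤ T then D.H t else K
  hermitian t ht := by
    split_ifs with h
    · exact D.hermitian t ⟨ht.1, h⟩
    · exact hK
  integrable r s := by
    refine IntervalIntegrable.trans (b := T) ((D.integrable r s).congr ?_)
      ((intervalIntegrable_const (c := K r s)).congr ?_)
    · intro t ht
      rw [Set.uIoc_of_le hT] at ht
      simp [ht.2]
    · intro t ht
      rw [Set.uIoc_of_le (by linarith)] at ht
      simp [not_le.2 ht.1]

/-- If `V` propagates the constant driving Hamiltonian `K`, then following it after `U` propagates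
the appended driving Hamiltonian. -/
theorem IsPropagator.append {N : ℕ} {W : Type} [Fintype W] [DecidableEq W] {T : ℝ}
    {D : DrivingHamiltonian N W T} {x : Fin N → Bool}
    {U : ℝ → Matrix (Basis N W) (Basis N W) ℂ} (hU : IsPropagator D x U)
    (hT : 0 ≤ T) {δ : ℝ} (hδ : 0 ≤ δ) {K : Matrix (Basis N W) (Basis N W) ℂ}
    (hK : K.IsHermitian) {V : ℝ → Matrix (Basis N W) (Basis N W) ℂ} (hV0 : V 0 = 1)
    (hV : ∀ t r s, HasDerivAt (fun t => V t r s)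
      (-Complex.I * ((queryHamiltonian W x + K) * V t) r s) t) :
    IsPropagator (D.append hT hδ K hK) x
      (fun t => if t ≤ T then U t else V (t - T) * U T) := by
  have hVc : Continuous V := continuous_pi fun r => continuous_pi fun s =>
    continuous_iff_continuousAt.2 fun t => (hV t r s).continuousAt
  have hY : ∀ t r s, HasDerivAt (fun t => (V (t - T) * U T) r s)
      (-Complex.I * ((queryHamiltonian W x + K) * (V (t - T) * U T)) r s) t := by
    intro t r s
    have h := HasDerivAt.fun_sum (u := Finset.univ) (x := t) fun i _ =>
      ((hV (t - T) r i).comp_sub_const t T).mul_const (U T i s)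
    refine h.congr_deriv ?_
    rw [← Matrix.mul_assoc, Matrix.mul_apply]
    simp only [Finset.mul_sum, mul_assoc]
  refine ⟨?_, fun t ht r s => ?_⟩
  · refine ContinuousOn.if (fun t ht => ?_) (hU.continuousOn.mono fun t ht => ?_) ?_
    · have : t = T := by simpa [Set.Iic_def, frontier_Iic] using ht.2
      subst this
      simp [hV0]
    · exact ⟨ht.1.1, closure_minimal (fun _ h => h) isClosed_Iic ht.2⟩
    · exact (Continuous.mul (hVc.comp (continuous_id.sub continuous_const))
        continuous_const).continuousOn
  · have hint : ∀ {a : ℝ}, a ∈ Set.Icc 0 T → Set.EqOn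
        (fun τ => ((queryHamiltonian W x + (D.append hT hδ K hK).H τ)
          * (if τ ≤ T then U τ else V (τ - T) * U T)) r s)
        (fun τ => ((queryHamiltonian W x + D.H τ) * U τ) r s) (Set.uIcc 0 a) := by
      intro a ha τ hτ
      rw [Set.uIcc_of_le ha.1] at hτ
      simp [DrivingHamiltonian.append, hτ.2.trans ha.2]
    by_cases h : t ≤ T
    · simp only [h, if_true]
      rw [hU.schrodinger t ⟨ht.1, h⟩ r s, intervalIntegral.integral_congr (hint ⟨ht.1, h⟩)]
    · have h' : T ≤ t := (not_le.1 h).le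
      have hI1 : IntervalIntegrable (fun τ => ((queryHamiltonian W x + D.H τ) * U τ) r s)
          volume 0 T := by
        simp only [Matrix.mul_apply, Matrix.add_apply]
        rw [← Finset.sum_fn]
        refine IntervalIntegrable.sum Finset.univ fun i _ => ?_
        refine (intervalIntegrable_const.add (D.integrable r i)).mul_continuousOn ?_
        rw [Set.uIcc_of_le hT]
        exact fun τ hτ => ((continuous_apply_apply i s).continuousAt).comp_continuousWithinAt
          (hU.continuousOn τ hτ)
      have hcY : Continuous fun τ => ((queryHamiltonian W x + K) * (V (τ - T) * U T)) r s :=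
        (continuous_apply_apply r s).comp (continuous_const.mul
          (Continuous.mul (hVc.comp (continuous_id.sub continuous_const)) continuous_const))
      -- The half-open interval leaves out `τ = T`, where the first branch is still in force.
      have hI2 : Set.EqOn
          (fun τ => ((queryHamiltonian W x + K) * (V (τ - T) * U T)) r s)
          (fun τ => ((queryHamiltonian W x + (D.append hT hδ K hK).H τ)
          * (if τ ≤ T then U τ else V (τ - T) * U T)) r s) (Set.uIoc T t) := by
        intro τ hτ
        rw [Set.uIoc_of_le h'] at hτ
        simp [DrivingHamiltonian.append, not_le.2 hτ.1]
      rw [← intervalIntegral.integral_add_adjacent_intervals (b := T)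
        (hI1.congr fun τ hτ => (hint ⟨hT, le_rfl⟩ (Set.uIoc_subset_uIcc hτ)).symm)
        ((hcY.intervalIntegrable T t).congr hI2),
        intervalIntegral.integral_congr (hint ⟨hT, le_rfl⟩),
        ← intervalIntegral.integral_congr_ae (Filter.Eventually.of_forall hI2)]
      have hftc := intervalIntegral.integral_eq_sub_of_hasDerivAt (a := T) (b := t)
        (fun τ _ => hY τ r s) ((continuous_const.mul hcY).intervalIntegrable T t)
      rw [intervalIntegral.integral_const_mul] at hftc
      have hUT := hU.schrodinger T ⟨hT, le_rfl⟩ r s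
      simp only [sub_self, hV0, one_mul] at hftc
      simp only [h, if_false]
      linear_combination (-1 : ℂ) * hftc + hUT

/-! ### Two-level Rabi oscillations -/

/-- The generalized Rabi frequency of a two-level system with coupling `g` and detuning `y`. -/
def rabiFrequency (g y : ℝ) : ℝ := Real.sqrt (g ^ 2 + (y / 2) ^ 2)

theorem rabiFrequency_pos {g : ℝ} (hg : 0 < g) (y : ℝ) : 0 < rabiFrequency g y :=
  Real.sqrt_pos.2 (by positivity)

theorem rabiFrequency_sq (g y : ℝ) : rabiFrequency g y ^ 2 = g ^ 2 + (y / 2) ^ 2 :=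
  Real.sq_sqrt (by positivity)

/-- Survival amplitude under the Hamiltonian `!![0, g; g, y]`: the diagonal entry of its propagator
at the first basis state for `σ = 1`, and at the second one for `σ = -1`. -/
def rabiDiagonal (g y σ : ℝ) (t : ℝ) : ℂ :=
  Complex.exp (-(Complex.I * (y / 2) * t)) * (Complex.cos (rabiFrequency g y * t)
    + σ * (Complex.I * (y / (2 * rabiFrequency g y))) * Complex.sin (rabiFrequency g y * t))

/-- Transition amplitude under the Hamiltonian `!![0, g; g, y]`. -/
def rabiTransition (g y : ℝ) (t : ℝ) : ℂ :=
  Complex.exp (-(Complex.I * (y / 2) * t))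
    * (-(Complex.I * (g / rabiFrequency g y)) * Complex.sin (rabiFrequency g y * t))

theorem hasDerivAt_exp_mul_trig (a ω p r : ℂ) (t : ℝ) :
    HasDerivAt (fun t : ℝ => Complex.exp (-(a * t))
        * (p * Complex.cos (ω * t) + r * Complex.sin (ω * t)))
      (Complex.exp (-(a * t)) * ((r * ω - a * p) * Complex.cos (ω * t)
        + (-(p * ω) - a * r) * Complex.sin (ω * t))) t := by
  have hω : HasDerivAt (fun z : ℂ => ω * z) ω (t : ℂ) := by
    simpa using (hasDerivAt_id (t : ℂ)).const_mul ω
  have ha : HasDerivAt (fun z : ℂ => -(a * z)) (-a) (t : ℂ) := by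
    simpa using ((hasDerivAt_id (t : ℂ)).const_mul a).fun_neg
  have h := (ha.cexp.mul ((hω.ccos.const_mul p).add (hω.csin.const_mul r))).comp_ofReal
  refine h.congr_deriv ?_
  simp only [Pi.add_apply]
  ring

theorem hasDerivAt_rabiTransition {g : ℝ} (hg : 0 < g) (y t : ℝ) :
    HasDerivAt (rabiTransition g y) (-Complex.I * (g * rabiDiagonal g y (-1) t)) t := by
  have hΩ : (rabiFrequency g y : ℂ) ≠ 0 := by exact_mod_cast (rabiFrequency_pos hg y).ne'
  have h := hasDerivAt_exp_mul_trig (Complex.I * (y / 2)) (rabiFrequency g y) 0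
    (-(Complex.I * (g / rabiFrequency g y))) t
  convert h using 1
  · ext u; simp [rabiTransition]
  · simp only [rabiDiagonal]
    push_cast
    field_simp
    ring_nf

/-- This is the off-diagonal entry of the identity saying that the propagator commutes with `!![0,
g; g, y]`. -/
theorem rabiDiagonal_neg_one {g : ℝ} (hg : 0 < g) (y t : ℝ) :
    (g : ℂ) * rabiDiagonal g y (-1) t = y * rabiTransition g y t + g * rabiDiagonal g y 1 t := by
  have hΩ : (rabiFrequency g y : ℂ) ≠ 0 := by exact_mod_cast (rabiFrequency_pos hg y).ne'
  simp only [rabiDiagonal, rabiTransition]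
  push_cast
  field_simp
  ring

theorem hasDerivAt_rabiDiagonal_one {g : ℝ} (hg : 0 < g) (y t : ℝ) :
    HasDerivAt (rabiDiagonal g y 1) (-Complex.I * (g * rabiTransition g y t)) t := by
  have hΩ : (rabiFrequency g y : ℂ) ≠ 0 := by exact_mod_cast (rabiFrequency_pos hg y).ne'
  have hsq : (rabiFrequency g y : ℂ) ^ 2 = g ^ 2 + (y / 2) ^ 2 := by
    exact_mod_cast rabiFrequency_sq g y
  have h := hasDerivAt_exp_mul_trig (Complex.I * (y / 2)) (rabiFrequency g y) 1
    (Complex.I * (y / (2 * rabiFrequency g y))) t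
  convert h using 1
  · ext u; simp [rabiDiagonal]
  · simp only [rabiTransition]
    generalize Complex.exp _ = e
    generalize Complex.sin _ = S
    generalize Complex.cos _ = C
    field_simp
    linear_combination (4 * e * S) * hsq + (e * S * (4 * g ^ 2 + y ^ 2)) * Complex.I_sq

theorem hasDerivAt_rabiDiagonal_neg_one {g : ℝ} (hg : 0 < g) (y t : ℝ) :
    HasDerivAt (rabiDiagonal g y (-1))
      (-Complex.I * (y * rabiDiagonal g y (-1) t + g * rabiTransition g y t)) t := by
  have hgc : (g : ℂ) ≠ 0 := by exact_mod_cast hg.ne'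
  have hfun : rabiDiagonal g y (-1) =
      fun t => y / g * rabiTransition g y t + rabiDiagonal g y 1 t := by
    ext u
    have := rabiDiagonal_neg_one hg y u
    field_simp
    linear_combination this
  rw [hfun]
  refine (((hasDerivAt_rabiTransition hg y t).const_mul (y / g : ℂ)).add
    (hasDerivAt_rabiDiagonal_one hg y t)).congr_deriv ?_
  rw [hfun]
  field_simp
  ring

theorem rabiDiagonal_resonant {g : ℝ} (hg : 0 < g) {t : ℝ} (ht : g * t = Real.pi / 2) :
    rabiDiagonal g 0 1 t = 0 := by
  have h : rabiFrequency g 0 = g := by simp [rabiFrequency, Real.sqrt_sq hg.le]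
  have : (g : ℂ) * t = Real.pi / 2 := by exact_mod_cast ht
  simp [rabiDiagonal, h, this]

/-- Up to a phase the amplitude is `cos + i * c * sin` with `0 ≤ c ≤ 1`, so its squared modulus is
at least `c ^ 2`: detuning prevents complete transfer. -/
theorem le_norm_rabiDiagonal {g y : ℝ} (hg : 0 < g) (hy : 0 ≤ y) (t : ℝ) :
    y / (2 * rabiFrequency g y) ≤ ‖rabiDiagonal g y 1 t‖ := by
  have hΩ := rabiFrequency_pos hg y
  set c := y / (2 * rabiFrequency g y) with hc
  have hc0 : 0 ≤ c := by positivity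
  have hc1 : c ^ 2 ≤ 1 := by
    rw [hc, div_pow, div_le_one (by positivity), mul_pow, rabiFrequency_sq]
    nlinarith [sq_nonneg g]
  have hnorm : ‖rabiDiagonal g y 1 t‖ = ‖((Real.cos (rabiFrequency g y * t) : ℝ)
      + (c * Real.sin (rabiFrequency g y * t) : ℝ) * Complex.I : ℂ)‖ := by
    rw [rabiDiagonal, norm_mul, show -(Complex.I * ((y : ℂ) / 2) * t)
      = ((-(y / 2 * t) : ℝ) : ℂ) * Complex.I by push_cast; ring, Complex.norm_exp_ofReal_mul_I,
      one_mul]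
    congr 1
    rw [hc]
    push_cast
    ring
  rw [hnorm, Complex.norm_add_mul_I]
  refine Real.le_sqrt_of_sq_le ?_
  have := Real.sin_sq_add_cos_sq (rabiFrequency g y * t)
  nlinarith [sq_nonneg (Real.cos (rabiFrequency g y * t))]

/-! ### The pulse sequence on the full register -/

/-- Coupling of strength `g` between the basis states `h` and `k`. -/
def coupling {ι : Type*} [DecidableEq ι] (g : ℝ) (h k : ι) : Matrix ι ι ℂ :=
  Matrix.single h k (g : ℂ) + Matrix.single k h (g : ℂ)

theorem coupling_isHermitian {ι : Type*} [DecidableEq ι] (g : ℝ) (h k : ι) :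
    (coupling g h k).IsHermitian := by
  simp [Matrix.IsHermitian, coupling, Matrix.conjTranspose_add, add_comm]

/-- Propagator of `diagonal d + coupling g h k` when `d h = 0`. -/
def couplingPropagator {ι : Type*} [DecidableEq ι] (g : ℝ) (d : ι → ℝ) (h k : ι) (t : ℝ) :
    Matrix ι ι ℂ := fun r s =>
  if r = h then
    if s = h then rabiDiagonal g (d k) 1 t else if s = k then rabiTransition g (d k) t else 0
  else if r = k then
    if s = h then rabiTransition g (d k) t else if s = k then rabiDiagonal g (d k) (-1) t else 0
  else if r = s then Complex.exp (-(Complex.I * d r * t)) else 0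

theorem couplingPropagator_zero {ι : Type*} [DecidableEq ι] (g : ℝ) (d : ι → ℝ) {h k : ι}
    (hk : h ≠ k) : couplingPropagator g d h k 0 = 1 := by
  ext r s
  simp only [couplingPropagator, Matrix.one_apply, rabiDiagonal, rabiTransition]
  by_cases h1 : r = h <;> by_cases h2 : s = h <;> by_cases h3 : r = k <;> by_cases h4 : s = k <;>
    simp_all [eq_comm]

theorem hasDerivAt_couplingPropagator {ι : Type*} [Fintype ι] [DecidableEq ι] {g : ℝ} (hg : 0 < g)
    {d : ι → ℝ} {h k : ι} (hk : h ≠ k) (hd : d h = 0) (t : ℝ) (r s : ι) :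
    HasDerivAt (fun t => couplingPropagator g d h k t r s)
      (-Complex.I * ((Matrix.diagonal (fun i => (d i : ℂ)) + coupling g h k)
        * couplingPropagator g d h k t) r s) t := by
  have hmul : ∀ M : Matrix ι ι ℂ, ((Matrix.diagonal (fun i => (d i : ℂ)) + coupling g h k) * M) r s
      = d r * M r s + ((if r = h then g * M k s else 0) + if r = k then g * M h s else 0) := by
    intro M
    rw [Matrix.add_mul, coupling, Matrix.add_mul, Matrix.add_apply, Matrix.add_apply,
      Matrix.diagonal_mul]
    congr 2
    · split_ifs with h1
      · subst h1; simp
      · exact Matrix.single_mul_apply_of_ne _ _ _ _ _ h1 _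
    · split_ifs with h1
      · subst h1; simp
      · exact Matrix.single_mul_apply_of_ne _ _ _ _ _ h1 _
  rw [hmul]
  by_cases hrh : r = h
  · subst hrh
    simp only [couplingPropagator, hd, hk, hk.symm, if_true, if_false]
    split_ifs
    · simpa using hasDerivAt_rabiDiagonal_one hg (d k) t
    · simpa using hasDerivAt_rabiTransition hg (d k) t
    · simpa using hasDerivAt_const t (0 : ℂ)
  · by_cases hrk : r = k
    · subst hrk
      simp only [couplingPropagator, hk.symm, if_true, if_false]
      split_ifs
      · simpa [rabiDiagonal_neg_one hg] using hasDerivAt_rabiTransition hg (d r) t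
      · simpa using hasDerivAt_rabiDiagonal_neg_one hg (d r) t
      · simpa using hasDerivAt_const t (0 : ℂ)
    · simp only [couplingPropagator, hrh, hrk, if_false]
      split_ifs
      · refine ((hasDerivAt_exp_mul_trig (Complex.I * d r) 0 1 0 t).congr_deriv ?_)
          |>.congr_of_eventuallyEq (Filter.Eventually.of_forall fun u => ?_) <;> simp
        ring
      · simpa using hasDerivAt_const t (0 : ℂ)

/-- There is a driving Hamiltonian which, in the `j`-th time slot of length `δ`, couples the state
`h = |0⟩|0⟩` to `|j⟩|1⟩`: the amplitude of remaining in `h` is the product of the survival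
amplitudes of the slots. -/
theorem exists_propagator_prod {N : ℕ} (h₀ : Fin N) {g δ : ℝ} (hg : 0 < g) (hδ : 0 < δ) (m : ℕ) :
    m ≤ N → ∃ (D : DrivingHamiltonian N Unit (m * δ))
      (U : (Fin N → Bool) → ℝ → Matrix (Basis N Unit) (Basis N Unit) ℂ),
      (∀ x, IsPropagator D x (U x)) ∧ ∀ x,
        U x (m * δ) ((h₀, false), ()) ((h₀, false), ())
          = ∏ j : Fin N with j.val < m, rabiDiagonal g (if x j then Real.pi else 0) 1 δ ∧
        ∀ j : Fin N, m ≤ j → U x (m * δ) ((j, true), ()) ((h₀, false), ()) = 0 := by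
  induction m with
  | zero =>
    intro _
    refine ⟨⟨fun _ => 0, fun _ _ => Matrix.isHermitian_zero, fun r s => by simp⟩,
      fun _ _ => 1, fun x => ⟨continuousOn_const, fun t ht r s => ?_⟩, fun x => ⟨by simp, ?_⟩⟩
    · have : t = 0 := by simpa using ht
      simp [this]
    · simp
  | succ m ih =>
    intro hm
    obtain ⟨D, U, hU, hval⟩ := ih (by omega)
    have hT : 0 ≤ (m : ℝ) * δ := by positivity
    set h : Basis N Unit := ((h₀, false), ()) with hh
    set k : Basis N Unit := ((⟨m, hm⟩, true), ()) with hkdef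
    have hk : h ≠ k := by simp [hh, hkdef]
    have hne : ∀ j : Fin N, ((j, true), ()) ≠ h := fun j => by simp [hh]
    let d : (Fin N → Bool) → Basis N Unit → ℝ := fun x s => if s.1.2 && x s.1.1 then Real.pi else 0
    have hd : ∀ x, queryHamiltonian Unit x = Matrix.diagonal fun i => (d x i : ℂ) := fun x => by
      simp only [queryHamiltonian, d, apply_ite ((↑) : ℝ → ℂ), Complex.ofReal_zero]
    -- `h` has `b = 0`, so it has energy zero for every input and the detuning of the slot is `π *
    -- x_m`.
    have hdh : ∀ x, d x h = 0 := fun x => by simp [d, hh]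
    have hdk : ∀ x, d x k = if x ⟨m, hm⟩ then Real.pi else 0 := fun x => by simp [d, hkdef]
    rw [show ((m + 1 : ℕ) : ℝ) * δ = m * δ + δ by push_cast; ring]
    refine ⟨D.append hT hδ.le (coupling g h k) (coupling_isHermitian g h k), _, fun x =>
      (hU x).append hT hδ.le (coupling_isHermitian g h k)
        (couplingPropagator_zero g (d x) hk) fun t r s => ?_, fun x => ⟨?_, fun j hj => ?_⟩⟩
    · rw [hd]
      exact hasDerivAt_couplingPropagator hg hk (hdh x) t r s
    all_goals
      simp only [add_le_iff_nonpos_right, not_le.2 hδ, if_false, add_sub_cancel_left,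
        Matrix.mul_apply]
    · rw [Finset.sum_eq_single h]
      · have hset : (Finset.univ.filter fun j : Fin N => j.val < m + 1)
            = insert ⟨m, hm⟩ (Finset.univ.filter fun j : Fin N => j.val < m) := by
          ext j
          simp [Fin.ext_iff]
          omega
        rw [hset, Finset.prod_insert (by simp), (hval x).1]
        simp [couplingPropagator, hdk]
      · intro i _ hi
        -- Return from `k` contributes nothing, because `k` is unpopulated before its own slot; this
        -- is why the induction carries the second clause.
        by_cases hik : i = k
        · rw [hik, (hval x).2 _ le_rfl, mul_zero]
        · simp [couplingPropagator, hi, hik]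
      · simp
    · have hjk : ((j, true), ()) ≠ k := by
        simp [hkdef, Fin.ext_iff]
        omega
      rw [Finset.sum_eq_single ((j, true), ())]
      · rw [(hval x).2 j (by omega), mul_zero]
      · intro i _ hi
        simp [couplingPropagator, hne, hjk, hi.symm]
      · simp

/-! ### From degree to simulation error -/

/-- If a transition amplitude vanishes on all proper subsets of `J`, then a circuit with fewer than
`|J|` queries can only simulate it with an error that is large compared to its value on `J`. -/
theorem Simulates.norm_le_two_pow_mul {N : ℕ} {W A : Type} [Fintype W] [DecidableEq W] [Fintype A]
    [DecidableEq A] {q : ℕ} {G : ℕ → Matrix.unitaryGroup (Basis N (W × A)) ℂ}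
    {χ : EuclideanSpace ℂ A} {V : (Fin N → Bool) → Matrix (Basis N W) (Basis N W) ℂ} {ε : ℝ}
    (hsim : Simulates q G χ V ε) {J : Finset (Fin N)} (hJ : q < J.card) (h : Basis N W)
    (hV : ∀ s ∈ J.powerset, s ≠ J → V (inputOfSupport s) h h = 0) :
    ‖V (inputOfSupport J) h h‖ ≤ 2 ^ J.card * ε := by
  let ψ : EuclideanSpace ℂ (Basis N W) := EuclideanSpace.single h 1
  -- The unnormalized ancilla state alongside `h`. It is kept as a vector because the final ancilla
  -- state `φ` may depend on the input.
  let out : Finset (Fin N) → EuclideanSpace ℂ A := fun s => WithLp.toLp 2 fun a =>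
    Matrix.toEuclideanLin (circuit G (inputOfSupport s) q) (withAncilla ψ χ) (h.1, h.2, a)
  have hclose : ∀ s, ∃ φ : EuclideanSpace ℂ A, ‖φ‖ = 1 ∧
      ‖out s - V (inputOfSupport s) h h • φ‖ ≤ ε := by
    intro s
    obtain ⟨φ, hφ, hb⟩ := hsim (inputOfSupport s)
    refine ⟨φ, hφ, le_trans ?_ ((hb ψ).trans (by simp [ψ]))⟩
    rw [EuclideanSpace.norm_eq, EuclideanSpace.norm_eq]
    refine Real.sqrt_le_sqrt ?_
    rw [Fintype.sum_prod_type]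
    refine le_trans ?_ (Finset.single_le_sum (fun i _ => by positivity) (Finset.mem_univ h.1))
    rw [Fintype.sum_prod_type]
    refine le_trans ?_ (Finset.single_le_sum (fun i _ => by positivity) (Finset.mem_univ h.2))
    refine le_of_eq (Finset.sum_congr rfl fun a _ => ?_)
    simp [out, ψ, withAncilla]
  have hsum : ∑ s ∈ J.powerset, (-1 : ℂ) ^ s.card • out s = 0 := by
    ext a
    have hmem : (fun s => out s a) ∈ degreeLE N q := by
      convert sum_const_mul_mem_degreeLE (fun i => withAncilla ψ χ i)
        (fun i => circuit_mem_degreeLE G q (h.1, h.2, a) i) using 1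
      ext s
      simp [out, Matrix.mulVec, dotProduct, mul_comm]
    simpa using sum_powerset_neg_one_pow_mul_eq_zero hJ hmem
  have hJmem : J ∈ J.powerset := Finset.mem_powerset_self J
  -- The top term is minus the sum of the `2 ^ J.card - 1` others, each of norm at most `ε` whatever
  -- its `φ` is, since its target is zero.
  have hout : ‖out J‖ ≤ (2 ^ J.card - 1) * ε := by
    rw [← Finset.add_sum_erase _ _ hJmem, add_eq_zero_iff_eq_neg] at hsum
    calc ‖out J‖ = ‖(-1 : ℂ) ^ J.card • out J‖ := by simp [norm_smul]
      _ ≤ ∑ s ∈ J.powerset.erase J, ε := by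
          rw [hsum, norm_neg]
          refine norm_sum_le_of_le _ fun s hs => ?_
          obtain ⟨hsJ, hs⟩ := Finset.mem_erase.1 hs
          obtain ⟨φ, -, hb⟩ := hclose s
          simpa [norm_smul, hV s hs hsJ] using hb
      _ = (2 ^ J.card - 1) * ε := by
          rw [Finset.sum_const, Finset.card_erase_of_mem hJmem, Finset.card_powerset,
            nsmul_eq_mul, Nat.cast_sub Nat.one_le_two_pow]
          push_cast
          ring
  obtain ⟨φ, hφ, hb⟩ := hclose J
  have : ‖V (inputOfSupport J) h h • φ‖ ≤ ‖out J‖ + ε := by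
    rw [norm_sub_rev] at hb
    linarith [norm_sub_norm_le (V (inputOfSupport J) h h • φ) (out J)]
  rw [norm_smul, hφ, mul_one] at this
  linarith

/-- For every `m ≥ 1` some driving Hamiltonian on `m` bits forces every simulation with fewer than
`m` queries to have error at least `(2 (1 + m / T))⁻ᵐ`. -/
theorem exists_driving_one_le_pow_mul {N m : ℕ} (hm : 0 < m) (hmN : m ≤ N) {T : ℝ} (hT : 0 < T) :
    ∃ (D : DrivingHamiltonian N Unit T)
      (U : (Fin N → Bool) → ℝ → Matrix (Basis N Unit) (Basis N Unit) ℂ),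
      (∀ x, IsPropagator D x (U x)) ∧
      ∀ (A : Type) [Fintype A] [DecidableEq A] (q : ℕ)
        (G : ℕ → Matrix.unitaryGroup (Basis N (Unit × A)) ℂ) (χ : EuclideanSpace ℂ A) (ε : ℝ),
        Simulates q G χ (fun x => U x T) ε → q < m → 1 ≤ (2 * (1 + m / T)) ^ m * ε := by
  have hm' : (0 : ℝ) < m := by exact_mod_cast hm
  set δ : ℝ := T / m with hδdef
  have hδ : 0 < δ := by positivity
  set g : ℝ := Real.pi / 2 / δ with hgdef
  have hg : 0 < g := by positivity
  have hgδ : g * δ = Real.pi / 2 := by rw [hgdef]; field_simp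
  have hTm : (m : ℝ) * δ = T := by rw [hδdef]; field_simp
  have hex := exists_propagator_prod ⟨0, hm.trans_le hmN⟩ hg hδ m hmN
  rw [hTm] at hex
  obtain ⟨D, U, hU, hval⟩ := hex
  refine ⟨D, U, hU, fun A _ _ q G χ ε hsim hq => ?_⟩
  let J : Finset (Fin N) := {j | j.val < m}
  have hJ : J.card = m := by
    simp [J, Fin.card_filter_val_lt, hmN]
  have key := hsim.norm_le_two_pow_mul (J := J) (by omega) ((⟨0, hm.trans_le hmN⟩, false), ()) ?_
  · have hone : ∀ j ∈ J, rabiDiagonal g (if inputOfSupport J j then Real.pi else 0) 1 δ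
        = rabiDiagonal g Real.pi 1 δ := fun j hj => by simp [inputOfSupport, hj]
    rw [(hval _).1, Finset.prod_congr rfl hone, Finset.prod_const, hJ, norm_pow] at key
    -- `Ω ≤ g + π / 2` with `g = π * m / (2 * T)`.
    have hΩ : rabiFrequency g Real.pi ≤ Real.pi / 2 * (1 + m / T) := by
      refine Real.sqrt_le_iff.2 ⟨by positivity, ?_⟩
      have : Real.pi / 2 * (1 + m / T) = g + Real.pi / 2 := by
        rw [hgdef, hδdef]
        field_simp
        ring
      rw [this]
      nlinarith [Real.pi_pos]
    have hle : 1 ≤ (1 + m / T) * ‖rabiDiagonal g Real.pi 1 δ‖ := by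
      have h1 := le_norm_rabiDiagonal hg Real.pi_pos.le δ
      rw [div_le_iff₀ (mul_pos two_pos (rabiFrequency_pos hg _))] at h1
      have h2 := mul_le_mul_of_nonneg_left hΩ (norm_nonneg (rabiDiagonal g Real.pi 1 δ))
      nlinarith [Real.pi_pos]
    calc (1 : ℝ) ≤ ((1 + m / T) * ‖rabiDiagonal g Real.pi 1 δ‖) ^ m := one_le_pow₀ hle
      _ ≤ (1 + m / T) ^ m * (2 ^ m * ε) := by
          rw [mul_pow]
          exact mul_le_mul_of_nonneg_left key (by positivity)
      _ = _ := by rw [mul_pow]; ring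
  -- A proper subset misses some `j ∈ J`, whose resonant slot contributes a zero factor.
  · intro s hs hsJ
    obtain ⟨j, hj, hjs⟩ := Finset.exists_of_ssubset
      (Finset.ssubset_iff_subset_ne.2 ⟨Finset.mem_powerset.1 hs, hsJ⟩)
    rw [(hval _).1]
    refine Finset.prod_eq_zero hj ?_
    simp [inputOfSupport, hjs, rabiDiagonal_resonant hg hgδ]

end ContinuousQuery

end

/-! ### Choice of parameters -/

theorem mainTheorem4 (T : ℝ) (hT : 0 < T) (c₁ c₂ : ℝ) (hc₁ : 0 < c₁) (hc₂ : c₁ ≤ c₂) :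
    ∃ κ > (0 : ℝ), ∃ ε₀ > (0 : ℝ), ∀ ε : ℝ, 0 < ε → ε < ε₀ →
      ∀ N : ℕ, c₁ * ContinuousQuery.rate ε ≤ N → (N : ℝ) ≤ c₂ * ContinuousQuery.rate ε →
        ∃ (W : Type) (_ : Fintype W) (_ : DecidableEq W)
          (D : ContinuousQuery.DrivingHamiltonian N W T)
          (U : (Fin N → Bool) → ℝ →
            Matrix (ContinuousQuery.Basis N W) (ContinuousQuery.Basis N W) ℂ),
          (∀ x, ContinuousQuery.IsPropagator D x (U x)) ∧
          ∀ (A : Type) [Fintype A] [DecidableEq A] (q : ℕ)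
            (G : ℕ → Matrix.unitaryGroup (ContinuousQuery.Basis N (W × A)) ℂ)
            (χ : EuclideanSpace ℂ A), ‖χ‖ = 1 →
            ContinuousQuery.Simulates q G χ (fun x => U x T) ε →
              κ * (N : ℝ) ≤ q := by
  have hc₂' : 0 < c₂ := hc₁.trans_le hc₂
  -- For large `L = log(1/ε)`: `L ≥ 4`, `log L ≥ max 1 (2 / T)` and `log L ≤ L / 4`.
  obtain ⟨L₀, hL₀⟩ := Filter.eventually_atTop.1 (((Filter.eventually_ge_atTop (4 : ℝ)).and
    (Real.tendsto_log_atTop.eventually_ge_atTop (max 1 (2 / T)))).and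
    (Real.isLittleO_log_id_atTop.bound (by norm_num : (0 : ℝ) < 1 / 4)))
  -- This `κ` gives `κ ≤ 1` and `κ * c₂ ≤ 1 / 4`; so `m ≤ N`, and `m ≤ R / 4 + 1 ≤ R / 2` as `R ≥
  -- 4`.
  refine ⟨1 / (4 * c₂ + 4), by positivity, Real.exp (-L₀), Real.exp_pos _,
    fun ε hε hε₀ N hN₁ hN₂ => ?_⟩
  set L := Real.log (1 / ε) with hL
  have hLL₀ : L₀ ≤ L := by
    rw [hL, one_div, Real.log_inv, le_neg]
    exact ((Real.log_lt_iff_lt_exp hε).2 hε₀).le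
  obtain ⟨⟨hL4, hlog⟩, hlo⟩ := hL₀ L hLL₀
  have hlog1 : 1 ≤ Real.log L := (le_max_left _ _).trans hlog
  have hlogT : 2 / T ≤ Real.log L := (le_max_right _ _).trans hlog
  have hlog0 : 0 < Real.log L := by linarith
  have hL0 : 0 < L := by linarith
  have hrate : ContinuousQuery.rate ε = L / Real.log L := rfl
  rw [hrate] at hN₁ hN₂
  set R := L / Real.log L with hR
  have hRL : R * Real.log L = L := by rw [hR]; field_simp
  have hR4 : 4 ≤ R := by
    rw [hR, le_div_iff₀ hlog0]
    simp only [id, Real.norm_eq_abs, abs_of_pos hlog0, abs_of_pos hL0] at hlo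
    linarith
  have hN0 : (0 : ℝ) < N := lt_of_lt_of_le (by positivity) hN₁
  set κ : ℝ := 1 / (4 * c₂ + 4) with hκ
  have hκ0 : 0 < κ := by positivity
  have hκ1 : κ ≤ 1 := by rw [hκ, div_le_one (by positivity)]; linarith
  have hκc : κ * c₂ ≤ 1 / 4 := by
    rw [hκ, one_div, inv_mul_le_iff₀ (by positivity)]; linarith
  set m := ⌈κ * N⌉₊ with hm
  have hm0 : 0 < m := Nat.ceil_pos.2 (by positivity)
  have hmN : m ≤ N := Nat.ceil_le.2 (by nlinarith)
  have hmR : (m : ℝ) ≤ R / 2 := by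
    have h1 : (m : ℝ) < κ * N + 1 := Nat.ceil_lt_add_one (by positivity)
    have h2 : κ * N ≤ κ * (c₂ * R) := mul_le_mul_of_nonneg_left hN₂ hκ0.le
    have h3 : κ * c₂ * R ≤ 1 / 4 * R := mul_le_mul_of_nonneg_right hκc (by linarith)
    linarith
  obtain ⟨D, U, hU, hD⟩ := ContinuousQuery.exists_driving_one_le_pow_mul hm0 hmN hT
  refine ⟨Unit, inferInstance, inferInstance, D, U, hU, fun A _ _ q G χ _ hsim => ?_⟩
  by_contra! hq
  have hqm : q < m := by
    have h : (q : ℝ) < m := hq.trans_le (Nat.le_ceil _)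
    exact_mod_cast h
  -- `2 * m / T ≤ R / T ≤ L / 2` by `log L ≥ 2 / T`, and `2 ≤ L / 2`.
  have hbase : 2 * (1 + m / T) ≤ L := by
    have h1 : 2 * (m / T) ≤ L / 2 := by
      rw [div_le_iff₀ hT] at hlogT
      rw [mul_div_assoc', div_le_iff₀ hT]
      nlinarith
    linarith
  -- `m * log L ≤ R * log L / 2 = L / 2`, which is beaten by `ε = exp (-L)`.
  have hpow : (2 * (1 + m / T)) ^ m ≤ Real.exp (L / 2) := by
    calc (2 * (1 + m / T)) ^ m ≤ L ^ m := pow_le_pow_left₀ (by positivity) hbase m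
      _ = Real.exp (m * Real.log L) := by rw [Real.exp_nat_mul, Real.exp_log hL0]
      _ ≤ Real.exp (L / 2) := Real.exp_le_exp.2 (by nlinarith)
  have hεL : ε = Real.exp (-L) := by
    rw [hL, one_div, Real.log_inv, neg_neg, Real.exp_log hε]
  have hlt : Real.exp (L / 2) * ε < 1 := by
    rw [hεL, ← Real.exp_add, Real.exp_lt_one_iff]
    linarith
  have := hD A q G χ ε hsim hqm
  linarith [mul_le_mul_of_nonneg_right hpow hε.le]
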